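/- Let $p$ be an odd prime, let $d>1$ be a squarefree integer coprime to $p$ with $d\equiv 2$ or $3 \pmod 4$, and let $q$ be a prime with $q\equiv 1\pmod p$ and $\left(\frac dq\right)=-1$ (equivalently, $q$ is inert in $\mathbb{Q}(\sqrt d)$). Let $K=\mathbb{Q}(\zeta_p,\sqrt d)$, let $R=\mathcal O_K$ be its ring of integers, $R_q=R/qR$, let $\mathfrak q$ be a prime ideal of $R$ lying over $q$, and let $\rho:R_q\to R/\mathfrak q$ be the reduction map. Let $N=[K:\mathbb Q]$ and let $\iota:K\to\mathbb R^{N}$ be the adjusted canonical embedding: it has one coordinate $\sigma(x)$ for each real embedding $\sigma$ of $K$, and two coordinates $\sqrt2\,\mathrm{Re}\,\sigma(x)$, $\sqrt2\,\mathrm{Im}\,\sigma(x)$ for each pair $\{\sigma,\overline\sigma\}$ of complex conjugate embeddings. For $r>0$ let $\rho_r(x)=e^{-\pi\|x\|^2/r^2}$ with $\|\cdot\|$ the Euclidean norm, and let $D_{\iota(R),r}$ be the discrete Gaussian distribution of width $r$ on the lattice $\iota(R)$, given by $D_{\iota(R),r}(x)=\rho_r(x)/\sum_{y\in\iota(R)}\rho_r(y)$.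 Let $\mathcal D$ be the distribution on $R_q$ obtained by drawing an element of $R$ according to $D_{\iota(R),r}$ (identifying $R$ with $\iota(R)$) and reducing it modulo $q$. Suppose $0<r<2\sqrt{\pi d}$, put $n=p-1$, and let $$\beta=\min\left\{\left(\frac{\sqrt{4\pi e d}}{r}\,e^{-\frac{2\pi d}{r^2}}\right)^{n},\,1\right\}.$$ Then $R/\mathfrak q$ is a field with $q^2$ elements, $R/\mathfrak q\cong\mathbb F_{q^2}$, and for $x\in R_q$ drawn according to $\mathcal D$ we have $\rho(x)\in\mathbb F_q$, where $\mathbb F_q\subset R/\mathfrak q$ is the prime subfield (with $q$ elements), with probability at least $1-\beta$. -/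

import Mathlib

open NumberField NumberField.InfinitePlace NumberField.mixedEmbedding
open scoped ENNReal Classical

noncomputable section

/-! ### Discrete Gaussians on lattices -/

/-- The Gaussian weight `ρ_r(x) = exp (-π ‖x‖² / r²)` of width `r`. -/
def gaussianWeight {E : Type*} [NormedAddCommGroup E] (r : ℝ) (x : E) : ℝ :=
  Real.exp (-Real.pi * ‖x‖ ^ 2 / r ^ 2)

lemma summable_gaussianWeight {E : Type*} [NormedAddCommGroup E] [NormedSpace ℝ E]
    [FiniteDimensional ℝ E] (L : Submodule ℤ E) [DiscreteTopology L] {r : ℝ} (hr : 0 < r) :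
    Summable fun x : L => gaussianWeight r (x : E) := by
  set m : ℕ := Module.finrank ℤ L + 1 with hm
  set c : ℝ := Real.pi / r ^ 2 with hc
  have hcpos : 0 < c := by positivity
  have hs : Summable fun z : L => ‖z‖⁻¹ ^ (2 * m) :=
    ZLattice.summable_norm_pow_inv L (2 * m) (by omega)
  refine Summable.of_norm_bounded_eventually (hs.mul_left ((m.factorial : ℝ) / c ^ m)) ?_
  refine (Set.finite_singleton (0 : L)).subset ?_
  intro x hx
  by_contra hx0
  apply hx
  have hxn : 0 < ‖x‖ := norm_pos_iff.mpr (by simpa using hx0)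
  have ht : 0 < c * ‖x‖ ^ 2 := by positivity
  have h1 : (c * ‖x‖ ^ 2) ^ m / (m.factorial : ℝ) ≤ Real.exp (c * ‖x‖ ^ 2) :=
    Real.pow_div_factorial_le_exp _ ht.le m
  have h2 : gaussianWeight r (x : E) = (Real.exp (c * ‖x‖ ^ 2))⁻¹ := by
    rw [gaussianWeight, ← Real.exp_neg, hc, Submodule.coe_norm]
    congr 1
    ring
  change ‖gaussianWeight r (x : E)‖ ≤ (m.factorial : ℝ) / c ^ m * ‖x‖⁻¹ ^ (2 * m)
  rw [h2, Real.norm_of_nonneg (by positivity)]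
  refine (inv_anti₀ (by positivity) h1).trans (le_of_eq ?_)
  rw [mul_pow, ← pow_mul, inv_div, inv_pow]
  field_simp

lemma tsum_gaussianWeight_ne_zero {E : Type*} [NormedAddCommGroup E]
    (L : Submodule ℤ E) (r : ℝ) :
    ∑' x : L, ENNReal.ofReal (gaussianWeight r (x : E)) ≠ 0 := by
  intro h
  have h0 := ENNReal.tsum_eq_zero.mp h 0
  rw [ENNReal.ofReal_eq_zero] at h0
  exact absurd h0 (not_le.mpr (Real.exp_pos _))

lemma tsum_gaussianWeight_ne_top {E : Type*} [NormedAddCommGroup E] [NormedSpace ℝ E]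
    [FiniteDimensional ℝ E] (L : Submodule ℤ E) [DiscreteTopology L] {r : ℝ} (hr : 0 < r) :
    ∑' x : L, ENNReal.ofReal (gaussianWeight r (x : E)) ≠ ∞ :=
  (summable_gaussianWeight L hr).tsum_ofReal_ne_top

/-- The discrete Gaussian distribution `D_{L,r}` on a discrete subgroup `L` of a Euclidean space:
the probability of `x ∈ L` is `ρ_r(x) / ∑_{y ∈ L} ρ_r(y)`. -/
def discreteGaussian {E : Type*} [NormedAddCommGroup E] [NormedSpace ℝ E]
    [FiniteDimensional ℝ E] (L : Submodule ℤ E) [DiscreteTopology L] {r : ℝ} (hr : 0 < r) :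
    PMF L :=
  PMF.normalize (fun x : L => ENNReal.ofReal (gaussianWeight r (x : E)))
    (tsum_gaussianWeight_ne_zero L r) (tsum_gaussianWeight_ne_top L hr)

/-! ### The adjusted canonical embedding and the lattice of the ring of integers -/

lemma span_natCast_le_of_liesOver {K : Type*} [Field K] (q : ℕ) (𝔮 : Ideal (𝓞 K))
    [h : 𝔮.LiesOver (Ideal.span {(q : ℤ)})] : Ideal.span {(q : 𝓞 K)} ≤ 𝔮 := by
  rw [Ideal.span_singleton_le_iff_mem]
  have := (Ideal.mem_of_liesOver 𝔮 (Ideal.span {(q : ℤ)}) (q : ℤ)).mp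
    (Ideal.mem_span_singleton_self _)
  simpa using this

section AdjustedEmbedding

variable (K : Type*) [Field K] [NumberField K]

/-- The adjusted canonical embedding `ι : K → ℝⁿ`, `n = [K : ℚ]`: one coordinate `σ(x)` for each
real embedding `σ`, and two coordinates `√2 Re σ(x)`, `√2 Im σ(x)` for each pair of conjugate
complex embeddings. The index type consists of the real places together with two copies of the
complex places, so it has `n` elements; the norm is the Euclidean one. -/
def adjustedEmbedding : K →+ EuclideanSpace ℝ (index K) where
  toFun x := WithLp.toLp 2 fun i => match i with
    | Sum.inl w => embedding_of_isReal w.2 x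
    | Sum.inr (w, 0) => Real.sqrt 2 * (w.1.embedding x).re
    | Sum.inr (w, 1) => Real.sqrt 2 * (w.1.embedding x).im
  map_zero' := by
    ext i
    rcases i with w | ⟨w, j⟩
    · simp
    · fin_cases j <;> simp
  map_add' x y := by
    ext i
    rcases i with w | ⟨w, j⟩
    · simp
    · fin_cases j <;> simp [mul_add]

/-- The restriction of the adjusted canonical embedding to the ring of integers `R` of `K`. -/
def integerEmbedding : 𝓞 K →ₗ[ℤ] EuclideanSpace ℝ (index K) :=
  ((adjustedEmbedding K).comp (algebraMap (𝓞 K) K).toAddMonoidHom).toIntLinearMap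

lemma integerEmbedding_apply (x : 𝓞 K) :
    integerEmbedding K x = adjustedEmbedding K (x : K) := rfl

lemma one_le_norm_integerEmbedding {x : 𝓞 K} (hx : x ≠ 0) : 1 ≤ ‖integerEmbedding K x‖ := by
  obtain ⟨φ, hφ⟩ := exists_conjugate_one_le_norm (K := K) hx
  have hw : 1 ≤ (InfinitePlace.mk φ) (x : K) := by
    simpa [InfinitePlace.apply] using hφ
  generalize InfinitePlace.mk φ = w at hw
  rcases w.isReal_or_isComplex with h | h
  · refine le_trans ?_ (PiLp.norm_apply_le _ (Sum.inl ⟨w, h⟩ : index K))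
    change 1 ≤ ‖embedding_of_isReal h (x : K)‖
    rwa [norm_embedding_of_isReal]
  · rw [← sq_le_sq₀ zero_le_one (norm_nonneg _), EuclideanSpace.norm_sq_eq]
    have hsub := Finset.sum_le_sum_of_subset_of_nonneg
      (f := fun i : index K => ‖integerEmbedding K x i‖ ^ 2)
      (Finset.subset_univ ({Sum.inr (⟨w, h⟩, 0), Sum.inr (⟨w, h⟩, 1)} : Finset (index K)))
      (fun _ _ _ => by positivity)
    refine le_trans ?_ hsub
    rw [Finset.sum_pair (by simp)]
    change (1 : ℝ) ^ 2 ≤ ‖Real.sqrt 2 * (w.embedding (x : K)).re‖ ^ 2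
      + ‖Real.sqrt 2 * (w.embedding (x : K)).im‖ ^ 2
    have h3 : ‖w.embedding (x : K)‖ ^ 2
        = (w.embedding (x : K)).re ^ 2 + (w.embedding (x : K)).im ^ 2 := by
      rw [← Complex.normSq_eq_norm_sq, Complex.normSq_apply]
      ring
    rw [norm_embedding_eq] at h3
    simp only [Real.norm_eq_abs, sq_abs, mul_pow, Real.sq_sqrt (zero_le_two : (0 : ℝ) ≤ 2)]
    nlinarith

lemma integerEmbedding_injective : Function.Injective (integerEmbedding K) := by
  rw [injective_iff_map_eq_zero]
  intro x hx
  by_contra h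
  have := one_le_norm_integerEmbedding K h
  rw [hx, norm_zero] at this
  linarith

/-- The lattice `ι(R)`, where `R` is the ring of integers of `K`. -/
def ringLattice : Submodule ℤ (EuclideanSpace ℝ (index K)) :=
  LinearMap.range (integerEmbedding K)

instance ringLattice_discreteTopology : DiscreteTopology (ringLattice K) := by
  refine discreteTopology_iff_isOpen_singleton_zero.mpr ⟨Metric.ball 0 1, Metric.isOpen_ball, ?_⟩
  ext y
  obtain ⟨x, hx⟩ := y.2
  rw [Set.mem_preimage, mem_ball_zero_iff, Set.mem_singleton_iff, ← Submodule.coe_eq_zero, ← hx]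
  constructor
  · intro h
    by_contra hne
    have := one_le_norm_integerEmbedding K (x := x) (by rintro rfl; exact hne (map_zero _))
    linarith
  · intro h
    rw [h, norm_zero]
    exact one_pos

/-- The bijection `R ≃ ι(R)` given by the adjusted canonical embedding. -/
def ringLatticeEquiv : 𝓞 K ≃ₗ[ℤ] ringLattice K :=
  LinearEquiv.ofInjective (integerEmbedding K) (integerEmbedding_injective K)

/-! ### The non-dual RLWE error distribution -/

/-- The quotient ring `R_q = R / qR`. -/
abbrev ModRing (q : ℕ) : Type _ := 𝓞 K ⧸ Ideal.span {(q : 𝓞 K)}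

/-- The non-dual discrete RLWE error distribution `D_{ι(R),r}`, as a distribution on `R`. -/
def errorDistribution {r : ℝ} (hr : 0 < r) : PMF (𝓞 K) :=
  (discreteGaussian (ringLattice K) hr).map (ringLatticeEquiv K).symm

/-- The non-dual discrete RLWE error distribution considered modulo `q`. -/
def errorDistributionMod (q : ℕ) {r : ℝ} (hr : 0 < r) : PMF (ModRing K q) :=
  (errorDistribution K hr).map (Ideal.Quotient.mk (Ideal.span {(q : 𝓞 K)}))

variable {K}

/-- The reduction map `R / qR → R / 𝔮`, for `𝔮` lying over `q`. -/
def reductionMap (q : ℕ) (𝔮 : Ideal (𝓞 K)) [𝔮.LiesOver (Ideal.span {(q : ℤ)})] :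
    ModRing K q →+* 𝓞 K ⧸ 𝔮 :=
  Ideal.Quotient.factor (span_natCast_le_of_liesOver q 𝔮)

/-- The prime subfield `𝔽_q` of the residue field `R / 𝔮`, that is, the image of `ℤ` in it. -/
def primeSubfield (𝔮 : Ideal (𝓞 K)) : Subring (𝓞 K ⧸ 𝔮) :=
  (Int.castRingHom (𝓞 K ⧸ 𝔮)).range

end AdjustedEmbedding

end

/-! The ring of integers splits as `R = ℤ[ζ] ⊕ ℤ[ζ]√d` (`exists_eq_add_mul_of_isIntegral`), and this
splitting is orthogonal under `ι`: `‖a + b√d‖² = ‖a‖² + d‖b‖²`. So the Gaussian weight of `a + b√d`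
is a product, and `b` follows a discrete Gaussian of width `r/√d` on `ι(ℤ[ζ])`. Since `q ≡ 1 mod p`,
the image of `ζ` in the residue field is fixed by Frobenius, so every element with `b = 0` reduces
into `𝔽_q`; the failure probability is at most the probability that `b ≠ 0`.

That probability is bounded by Banaszczyk's tail argument (`tsum_expWeight_ne_zero_le`). With `α =
πd/r²`, `n = p - 1` and `‖b‖² ≥ [K : ℚ] = 2n` for `b ≠ 0` (AM-GM and integrality of the norm), it is
at most `e^{-2n(α-γ)} (α/γ)^{n/2}` for any `0 < γ < α`. The best choice is `γ = 1/4`, which gives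
the constant in `β`; the condition `r < 2√(πd)` says exactly that `1/4 < α`.

For the residue field: `√d` is not in `𝔽_q` because `d` is a nonresidue, and the splitting of `R`
shows that `1, √d` span over `𝔽_q`. -/

noncomputable section

/-! ### Gaussian sums over full-rank lattices and their cosets. -/

section LatticeGaussian

open MeasureTheory Module

variable {E : Type*} [NormedAddCommGroup E]

/-- The exponential weight `exp (-α ‖x‖²)`, with values in `ℝ≥0∞`. -/
def expWeight (α : ℝ) (x : E) : ℝ≥0∞ := ENNReal.ofReal (Real.exp (-α * ‖x‖ ^ 2))

lemma measurable_expWeight [MeasurableSpace E] [OpensMeasurableSpace E] (α : ℝ) :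
    Measurable (expWeight α : E → ℝ≥0∞) :=
  ENNReal.measurable_ofReal.comp
    (Continuous.measurable (by fun_prop))

variable (L : Submodule ℤ E)

/-- The sum of the exponential weights over the coset `L + y`. -/
def expSum (α : ℝ) (y : E) : ℝ≥0∞ := ∑' x : L, expWeight α ((x : E) + y)

lemma expSum_add (α : ℝ) (x : L) (y : E) : expSum L α (x + y) = expSum L α y := by
  rw [expSum, expSum, ← (Equiv.addRight x).tsum_eq fun z : L => expWeight α ((z : E) + y)]
  refine tsum_congr fun z => ?_
  simp [add_assoc]

variable [InnerProductSpace ℝ E]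

/-- Completing the square in `z`; this makes the convolution of two Gaussians a Gaussian whose
inverse parameter is `1/α + 1/β`. -/
lemma mul_sq_norm_add_mul_sq_norm_add {α β : ℝ} (hα : 0 < α) (hβ : 0 < β) (x z : E) :
    α * ‖z‖ ^ 2 + β * ‖x + z‖ ^ 2
      = (α + β) * ‖z + (β / (α + β)) • x‖ ^ 2 + α * β / (α + β) * ‖x‖ ^ 2 := by
  rw [norm_add_sq_real x z, norm_add_sq_real z, inner_smul_right, _root_.norm_smul, mul_pow,
    Real.norm_eq_abs, sq_abs, real_inner_comm]
  field_simp
  ring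

variable [FiniteDimensional ℝ E] [MeasurableSpace E] [BorelSpace E]

lemma lintegral_expWeight {α : ℝ} (hα : 0 < α) :
    ∫⁻ z : E, expWeight α z = ENNReal.ofReal ((Real.pi / α) ^ (finrank ℝ E / 2 : ℝ)) := by
  have h := GaussianFourier.integral_rexp_neg_mul_sq_norm (V := E) hα
  rw [← h]
  refine (ofReal_integral_eq_lintegral_ofReal ?_ (.of_forall fun _ => (Real.exp_pos _).le)).symm
  -- A non-integrable function has integral `0` by convention, so the positive value of the integral
  -- forces integrability.
  refine not_imp_comm.mp integral_undef ?_
  rw [h]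
  positivity

lemma lintegral_expWeight_mul_expWeight {α β : ℝ} (hα : 0 < α) (hβ : 0 < β) (x : E) :
    ∫⁻ z : E, expWeight α z * expWeight β (x + z)
      = ENNReal.ofReal ((Real.pi / (α + β)) ^ (finrank ℝ E / 2 : ℝ))
        * expWeight (α * β / (α + β)) x := by
  have h (z : E) : expWeight α z * expWeight β (x + z)
      = expWeight (α + β) (z + (β / (α + β)) • x) * expWeight (α * β / (α + β)) x := by
    simp only [expWeight]
    rw [← ENNReal.ofReal_mul (Real.exp_pos _).le, ← ENNReal.ofReal_mul (Real.exp_pos _).le,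
      ← Real.exp_add, ← Real.exp_add]
    congr 2
    linarith [mul_sq_norm_add_mul_sq_norm_add hα hβ x z]
  simp_rw [h]
  rw [lintegral_mul_const _ (f := fun z : E => expWeight (α + β) (z + (β / (α + β)) • x))
      ((measurable_expWeight _).comp (measurable_add_const _)),
    lintegral_add_right_eq_self (fun z : E => expWeight (α + β) z),
    lintegral_expWeight (by positivity)]

lemma vaddInvariantMeasure_submodule :
    VAddInvariantMeasure L E (volume : Measure E) :=
  inferInstanceAs (VAddInvariantMeasure L.toAddSubgroup E (volume : Measure E))

lemma two_mul_mul_le_add (a b : ℝ≥0∞) : 2 * (a * b) ≤ a * a + b * b := by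
  wlog h : a ≤ b generalizing a b
  · rw [mul_comm a b, add_comm]
    exact this b a (le_of_not_ge h)
  · obtain ⟨c, rfl⟩ := exists_add_of_le h
    calc 2 * (a * (a + c)) ≤ 2 * (a * (a + c)) + c * c := le_self_add
      _ = a * a + (a + c) * (a + c) := by ring

variable [DiscreteTopology L] [IsZLattice ℝ L]

lemma measurable_expSum (α : ℝ) : Measurable (expSum L α) :=
  Measurable.tsum fun _ =>
    (measurable_expWeight α).comp (measurable_const_add _)

/-- Unfolding: the integral over a fundamental domain of a periodic function against a
periodized weight. -/
lemma setLIntegral_mul_expSum {ι : Type*} [Finite ι] (b : Basis ι ℤ L) (α : ℝ) {G : E → ℝ≥0∞}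
    (hG : Measurable G) (hGL : ∀ (x : L) (z : E), G (x + z) = G z) :
    ∫⁻ z in ZSpan.fundamentalDomain (b.ofZLatticeBasis ℝ), G z * expSum L α z
      = ∫⁻ z, G z * expWeight α z := by
  have := vaddInvariantMeasure_submodule L
  rw [(ZLattice.isAddFundamentalDomain b (volume : Measure E)).lintegral_eq_tsum'']
  simp only [expSum, ← ENNReal.tsum_mul_left]
  rw [lintegral_tsum]
  · refine tsum_congr fun x => lintegral_congr fun z => ?_
    rw [Submodule.vadd_def, vadd_eq_add, hGL]
  · exact fun x => (hG.mul ((measurable_expWeight α).comp (measurable_const_add _))).aemeasurable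

lemma lintegral_expSum_mul_expWeight {α β : ℝ} (hα : 0 < α) (hβ : 0 < β) (y : E) :
    ∫⁻ z, expSum L β (y + z) * expWeight α z
      = ENNReal.ofReal ((Real.pi / (α + β)) ^ (finrank ℝ E / 2 : ℝ))
        * expSum L (α * β / (α + β)) y := by
  simp only [expSum, ← ENNReal.tsum_mul_left, ← ENNReal.tsum_mul_right]
  rw [lintegral_tsum]
  · refine tsum_congr fun x => ?_
    rw [← lintegral_expWeight_mul_expWeight hα hβ]
    refine lintegral_congr fun z => ?_
    rw [mul_comm, add_assoc]
  · refine fun x => (Measurable.mul ?_ (measurable_expWeight α)).aemeasurable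
    exact (measurable_expWeight β).comp (by fun_prop)

/-- Among all cosets of a lattice, the lattice itself has the largest Gaussian mass. -/
lemma expSum_le_expSum_zero {γ : ℝ} (hγ : 0 < γ) (y : E) : expSum L γ y ≤ expSum L γ 0 := by
  have := vaddInvariantMeasure_submodule L
  have := ZLattice.module_free ℝ L
  have := ZLattice.module_finite ℝ L
  let b := Module.Free.chooseBasis ℤ L
  set D := ZSpan.fundamentalDomain (b.ofZLatticeBasis ℝ)
  -- The weight with parameter `γ` is, up to a constant, the self-convolution of the one with
  -- parameter `2γ`. Hence the mass of `L + y` is an autocorrelation of the periodic function `H`,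
  -- largest at `y = 0` by `2ab ≤ a² + b²`. No Poisson summation is needed.
  set α := 2 * γ with hαdef
  have hα : 0 < α := by positivity
  have hαγ : α * α / (α + α) = γ := by rw [hαdef]; field_simp; norm_num
  set H : E → ℝ≥0∞ := expSum L α
  have hH : Measurable H := measurable_expSum L α
  have hHy : Measurable fun z => H (y + z) := hH.comp (measurable_const_add y)
  have hHL (x : L) (z : E) : H (y + (x + z)) = H (y + z) := by
    rw [add_left_comm]; exact expSum_add L α x _
  set c := ENNReal.ofReal ((Real.pi / (α + α)) ^ (finrank ℝ E / 2 : ℝ))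
  have key (u : E) : ∫⁻ z, H (u + z) * expWeight α z = c * expSum L γ u := by
    rw [lintegral_expSum_mul_expWeight L hα hα, hαγ]
  have key0 : ∫⁻ z, H z * expWeight α z = c * expSum L γ 0 := by
    rw [← key 0]; simp
  have h1 : ∫⁻ z in D, H (y + z) * H z = c * expSum L γ y := by
    rw [← key, setLIntegral_mul_expSum L b α hHy hHL]
  have h2 : ∫⁻ z in D, H z * H z = c * expSum L γ 0 := by
    rw [← key0, setLIntegral_mul_expSum L b α hH (expSum_add L α)]
  -- The integral of `H²` over a period does not change under translation by `y`: one factor is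
  -- unfolded to an integral over all of `E`, where the translation is harmless.
  have h3 : ∫⁻ z in D, H (y + z) * H (y + z) = c * expSum L γ 0 := by
    have hp (z : E) : H (y + z) * H (y + z)
        = ∑' x : L, H (y + (x + z)) * expWeight α (y + (x + z)) := by
      conv_lhs => rw [show H (y + z) * H (y + z) = H (y + z) * expSum L α (y + z) from rfl]
      rw [expSum, ← ENNReal.tsum_mul_left]
      refine tsum_congr fun x => ?_
      rw [hHL, add_left_comm]
    simp_rw [hp]
    rw [lintegral_tsum, ← key0, ← lintegral_add_left_eq_self _ y,
      (ZLattice.isAddFundamentalDomain b (volume : Measure E)).lintegral_eq_tsum'']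
    · rfl
    · intro x
      refine (Measurable.mul ?_ ?_).aemeasurable
      · exact hH.comp (by fun_prop)
      · exact (measurable_expWeight α).comp (by fun_prop)
  have hc0 : c ≠ 0 := by
    rw [Ne, ENNReal.ofReal_eq_zero, not_le]; positivity
  have h4 : 2 * (c * expSum L γ y) ≤ 2 * (c * expSum L γ 0) := by
    calc 2 * (c * expSum L γ y) = ∫⁻ z in D, 2 * (H (y + z) * H z) := by
          rw [← h1, lintegral_const_mul 2 (f := fun z => H (y + z) * H z) (hHy.mul hH)]
      _ ≤ ∫⁻ z in D, (H (y + z) * H (y + z) + H z * H z) := by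
          refine lintegral_mono fun z => ?_
          exact two_mul_mul_le_add (H (y + z)) (H z)
      _ = 2 * (c * expSum L γ 0) := by
          rw [lintegral_add_left (f := fun z => H (y + z) * H (y + z)) (hHy.mul hHy), h2, h3, two_mul]
  rw [ENNReal.mul_le_mul_iff_right two_ne_zero ENNReal.ofNat_ne_top,
    ENNReal.mul_le_mul_iff_right hc0 ENNReal.ofReal_ne_top] at h4
  exact h4

/-- Comparison of the Gaussian masses of a lattice for two widths. -/
lemma expSum_zero_le {α γ : ℝ} (hγ : 0 < γ) (h : γ < α) :
    expSum L γ 0 ≤ ENNReal.ofReal ((α / γ) ^ (finrank ℝ E / 2 : ℝ)) * expSum L α 0 := by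
  have hα : 0 < α := hγ.trans h
  have hsub : 0 < α - γ := sub_pos.mpr h
  -- Chosen so that `1/γ = 1/α + 1/β`: the `γ`-sum at `0` is then the average of the periodized
  -- `α`-weight against a `β`-Gaussian, and the periodized weight is bounded by its value at `0`.
  set β := α * γ / (α - γ) with hβdef
  have hβ : 0 < β := by positivity
  have hβα : β + α = α ^ 2 / (α - γ) := by rw [hβdef]; field_simp; ring
  have hγ' : β * α / (β + α) = γ := by rw [hβα, hβdef]; field_simp
  have h1 := lintegral_expSum_mul_expWeight L hβ hα 0
  rw [hγ'] at h1
  have h2 : ∫⁻ z, expSum L α (0 + z) * expWeight β z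
      ≤ expSum L α 0 * ENNReal.ofReal ((Real.pi / β) ^ (finrank ℝ E / 2 : ℝ)) := by
    rw [← lintegral_expWeight hβ, ← lintegral_const_mul _ (measurable_expWeight β)]
    exact lintegral_mono fun z => mul_le_mul_left (expSum_le_expSum_zero L hα _) _
  rw [h1] at h2
  have hfac : (Real.pi / β) ^ (finrank ℝ E / 2 : ℝ)
      = (Real.pi / (β + α)) ^ (finrank ℝ E / 2 : ℝ) * (α / γ) ^ (finrank ℝ E / 2 : ℝ) := by
    rw [← Real.mul_rpow (by positivity) (by positivity), hβα, hβdef]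
    congr 1
    field_simp
  rw [hfac, ENNReal.ofReal_mul (by positivity), mul_left_comm] at h2
  rw [ENNReal.mul_le_mul_iff_right _ ENNReal.ofReal_ne_top] at h2
  · rwa [mul_comm] at h2
  · rw [Ne, ENNReal.ofReal_eq_zero, not_le]; positivity

end LatticeGaussian

/-! ### Discrete subgroups of arbitrary rank and the tail bound. -/

section DiscreteSubgroup

open Module

variable {V : Type*} [NormedAddCommGroup V] [InnerProductSpace ℝ V] [FiniteDimensional ℝ V]
  (L : Submodule ℤ V) [DiscreteTopology L]

/-- Comparison of the Gaussian masses of a discrete subgroup, not necessarily of full rank, for two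
widths. -/
lemma tsum_expWeight_le {α γ : ℝ} (hγ : 0 < γ) (h : γ < α) :
    ∑' x : L, expWeight γ (x : V)
      ≤ ENNReal.ofReal ((α / γ) ^ (finrank ℤ L / 2 : ℝ)) * ∑' x : L, expWeight α (x : V) := by
  -- Inside its real span the subgroup is a full lattice, so the exponent is governed by the rank of
  -- `L` and not by the dimension of `V`.
  let F := Submodule.span ℝ (L : Set V)
  let L' : Submodule ℤ F := ZLattice.comap ℝ L F.subtype
  let f : L' ≃ₗ[ℤ] L :=
    Submodule.comapSubtypeEquivOfLe (q := F.restrictScalars ℤ) Submodule.subset_span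
  have : DiscreteTopology L' :=
    ZLattice.comap_discreteTopology ℝ L continuous_subtype_val Subtype.val_injective
  have : IsZLattice ℝ L' := ⟨Submodule.span_span_coe_preimage⟩
  let : MeasurableSpace F := borel F
  have : BorelSpace F := ⟨rfl⟩
  have key := expSum_zero_le L' hγ h
  have hsum (δ : ℝ) : expSum L' δ 0 = ∑' x : L, expWeight δ (x : V) := by
    rw [expSum, ← f.toEquiv.tsum_eq]
    refine tsum_congr fun x => ?_
    rw [add_zero]
    rfl
  rw [hsum, hsum] at key
  rwa [← f.finrank_eq, ZLattice.rank ℝ L']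

/-- Banaszczyk's tail bound for the nonzero vectors of a discrete subgroup. -/
lemma tsum_expWeight_ne_zero_le {α γ R : ℝ} (hγ : 0 < γ) (h : γ < α)
    (hR : ∀ x ∈ L, x ≠ 0 → R ≤ ‖x‖ ^ 2) :
    ∑' x : L, (if x = 0 then 0 else expWeight α (x : V))
      ≤ ENNReal.ofReal (Real.exp (-(α - γ) * R) * (α / γ) ^ (finrank ℤ L / 2 : ℝ))
        * ∑' x : L, expWeight α (x : V) := by
  rw [ENNReal.ofReal_mul (Real.exp_pos _).le, mul_assoc]
  refine le_trans ?_ (mul_le_mul_right (tsum_expWeight_le L hγ h) _)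
  rw [← ENNReal.tsum_mul_left]
  refine ENNReal.tsum_le_tsum fun x => ?_
  split_ifs with hx
  · exact zero_le
  · simp only [expWeight]
    rw [← ENNReal.ofReal_mul (Real.exp_pos _).le, ← Real.exp_add]
    -- Here `e^{-α‖x‖²} = e^{-(α-γ)‖x‖²} e^{-γ‖x‖²}`, and the first factor is at most `e^{-(α-γ)R}`.
    refine ENNReal.ofReal_le_ofReal (Real.exp_le_exp.mpr ?_)
    have := hR x x.2 (by simpa using hx)
    nlinarith

end DiscreteSubgroup

/-! ### Arithmetic of `ℤ[ζ_p]`. -/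

section CyclotomicIntegers

open IntermediateField Module

variable {K : Type*} [Field K]

/-- On `ℤ[ζ]/ℓ` the `(p-1)`-st iterate of Frobenius is a ring homomorphism, and it fixes `ζ` because
`ℓ^(p-1) ≡ 1 mod p`; so it is the identity. -/
lemma exists_pow_sub_self_eq_mul (p ℓ : ℕ) [Fact p.Prime] [Fact ℓ.Prime] (h : ℓ.Coprime p)
    {ζ : K} (hζ : ζ ^ p = 1) {x : K} (hx : x ∈ Algebra.adjoin ℤ {ζ}) :
    ∃ y ∈ Algebra.adjoin ℤ {ζ}, x ^ ℓ ^ (p - 1) - x = ℓ * y := by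
  induction hx using Algebra.adjoin_induction with
  | mem x hx =>
    obtain rfl : x = ζ := hx
    refine ⟨0, zero_mem _, ?_⟩
    have h1 : ℓ ^ (p - 1) ≡ 1 [MOD p] := by
      rw [← Nat.totient_prime Fact.out]
      exact Nat.ModEq.pow_totient h
    rw [pow_eq_pow_of_modEq h1 hζ, pow_one, sub_self, mul_zero]
  | algebraMap n =>
    have h1 : (ℓ : ℤ) ∣ n ^ ℓ ^ (p - 1) - n := by
      rw [← ZMod.intCast_zmod_eq_zero_iff_dvd]
      push_cast
      rw [ZMod.pow_card_pow, sub_self]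
    obtain ⟨m, hm⟩ := h1
    refine ⟨algebraMap ℤ K m, Subalgebra.algebraMap_mem _ _, ?_⟩
    rw [← map_pow, ← map_sub, hm, map_mul, map_natCast]
  | add x y hx hy ihx ihy =>
    obtain ⟨u, hu, hu'⟩ := ihx
    obtain ⟨v, hv, hv'⟩ := ihy
    obtain ⟨r, hr⟩ := exists_add_pow_prime_pow_eq (Fact.out : ℓ.Prime)
      (⟨x, hx⟩ : Algebra.adjoin ℤ {ζ}) ⟨y, hy⟩ (p - 1)
    have hr' := congrArg (Subtype.val) hr
    push_cast at hr'
    refine ⟨u + v + x * y * r, add_mem (add_mem hu hv) (mul_mem (mul_mem hx hy) r.2), ?_⟩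
    linear_combination hr' + hu' + hv'
  | mul x y hx hy ihx ihy =>
    obtain ⟨u, hu, hu'⟩ := ihx
    obtain ⟨v, hv, hv'⟩ := ihy
    refine ⟨u * y ^ ℓ ^ (p - 1) + x * v, add_mem (mul_mem hu (pow_mem hy _)) (mul_mem hx hv), ?_⟩
    rw [mul_pow]
    linear_combination y ^ ℓ ^ (p - 1) * hu' + x * hv'

/-- `ℤ[ζ]/ℓ` is reduced: some power of Frobenius is the identity, so an element of square zero
vanishes. -/
lemma exists_eq_mul_of_sq_eq_prime_mul (p ℓ : ℕ) [Fact p.Prime] [Fact ℓ.Prime] (h : ℓ.Coprime p)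
    {ζ : K} (hζ : ζ ^ p = 1) {c y : K} (hc : c ∈ Algebra.adjoin ℤ {ζ})
    (hy : y ∈ Algebra.adjoin ℤ {ζ}) (hcy : c ^ 2 = ℓ * y) :
    ∃ z ∈ Algebra.adjoin ℤ {ζ}, c = ℓ * z := by
  obtain ⟨u, hu, hu'⟩ := exists_pow_sub_self_eq_mul p ℓ h hζ hc
  -- The exponent must be at least `2` for `c ^ 2` to split off.
  have h2 : 2 ≤ ℓ ^ (p - 1) := (Fact.out : ℓ.Prime).two_le.trans
    (Nat.le_self_pow (Nat.sub_pos_of_lt (Fact.out : p.Prime).one_lt).ne' _)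
  rw [← Nat.add_sub_cancel' h2, pow_add, hcy] at hu'
  refine ⟨y * c ^ (ℓ ^ (p - 1) - 2) - u, sub_mem (mul_mem hy (pow_mem hc _)) hu, ?_⟩
  linear_combination -hu'

lemma isIntegral_of_mem_adjoin {p : ℕ} [Fact p.Prime] {ζ : K} (hζ : IsPrimitiveRoot ζ p) {x : K}
    (hx : x ∈ Algebra.adjoin ℤ {ζ}) : IsIntegral ℤ x := by
  have : Algebra.adjoin ℤ {ζ} ≤ integralClosure ℤ K :=
    Algebra.adjoin_le (by simpa using show ζ ∈ integralClosure ℤ K from hζ.isIntegral (Fact.out : p.Prime).pos)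
  exact this hx

variable [CharZero K]

/-- `ℤ[ζ_p] / m` is reduced when `m` is squarefree and coprime to `p`. -/
lemma exists_eq_mul_of_sq_eq_mul (p m : ℕ) [Fact p.Prime] (hm : Squarefree m) (h : m.Coprime p)
    {ζ : K} (hζ : ζ ^ p = 1) {c y : K} (hc : c ∈ Algebra.adjoin ℤ {ζ})
    (hy : y ∈ Algebra.adjoin ℤ {ζ}) (hcy : c ^ 2 = m * y) :
    ∃ z ∈ Algebra.adjoin ℤ {ζ}, c = m * z := by
  induction m using induction_on_primes generalizing c y with
  | zero => exact absurd hm not_squarefree_zero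
  | one => exact ⟨c, hc, by simp⟩
  | prime_mul ℓ m hℓ ih =>
    have : Fact ℓ.Prime := ⟨hℓ⟩
    rw [Nat.squarefree_mul_iff] at hm
    obtain ⟨hcop, -, hm⟩ := hm
    push_cast at hcy
    obtain ⟨c', hc', rfl⟩ := exists_eq_mul_of_sq_eq_prime_mul p ℓ (h.coprime_mul_right) hζ hc
      (mul_mem (natCast_mem _ m) hy) (by rw [hcy, mul_assoc])
    have hℓ0 : (ℓ : K) ≠ 0 := Nat.cast_ne_zero.mpr (Nat.Prime.ne_zero hℓ)
    have h1 : ℓ * c' ^ 2 = m * y := mul_left_cancel₀ hℓ0 (by linear_combination hcy)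
    -- From `ℓ c'² = m y` and `uℓ + vm = 1` it follows that `c'² = m (u y + v c'²)`, which feeds the
    -- induction hypothesis.
    obtain ⟨u, v, huv⟩ := Nat.isCoprime_iff_coprime.mpr hcop
    have huv' : (u : K) * ℓ + v * m = 1 := by exact_mod_cast congrArg (Int.cast : ℤ → K) huv
    obtain ⟨z, hz, rfl⟩ := ih hm (h.coprime_mul_left) hc'
      (y := u * y + v * c' ^ 2)
      (add_mem (mul_mem (intCast_mem _ u) hy) (mul_mem (intCast_mem _ v) (pow_mem hc' 2)))
      (by linear_combination (-c' ^ 2) * huv' + u * h1)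
    exact ⟨z, hz, by push_cast; ring⟩

lemma natCast_dvd_of_eq_mul_isIntegral {m n : ℕ} (hm : m ≠ 0) {z : K} (hz : IsIntegral ℤ z)
    (h : (n : K) = m * z) : m ∣ n := by
  have hm' : (m : K) ≠ 0 := Nat.cast_ne_zero.mpr hm
  have hz' : z = algebraMap ℚ K (n / m) := by
    rw [map_div₀, map_natCast, map_natCast, h]; field_simp
  rw [hz', isIntegral_algebraMap_iff (algebraMap ℚ K).injective] at hz
  obtain ⟨k, hk⟩ := IsIntegrallyClosed.isIntegral_iff.mp hz
  have hm'' : (m : ℚ) ≠ 0 := Nat.cast_ne_zero.mpr hm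
  rw [eq_div_iff hm''] at hk
  rw [← Int.natCast_dvd_natCast]
  refine ⟨k, ?_⟩
  have : ((n : ℤ) : ℚ) = ((m * k : ℤ) : ℚ) := by
    push_cast
    rw [← hk, mul_comm]; rfl
  exact_mod_cast this

variable {p : ℕ} [Fact p.Prime] {ζ : K}

lemma mem_adjoin_of_isIntegral [Algebra.IsIntegral ℚ K] (hζ : IsPrimitiveRoot ζ p) {x : K}
    (hx : x ∈ ℚ⟮ζ⟯) (hxi : IsIntegral ℤ x) : x ∈ Algebra.adjoin ℤ {ζ} := by
  have hcyc : IsCyclotomicExtension {p} ℚ ℚ⟮ζ⟯ := by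
    convert! hζ.intermediateField_adjoin_isCyclotomicExtension ℚ
  have hζ' : IsPrimitiveRoot (AdjoinSimple.gen ℚ ζ) p :=
    IsPrimitiveRoot.coe_submonoidClass_iff.mp hζ
  have hcl := IsCyclotomicExtension.Rat.isIntegralClosure_adjoin_singleton_of_prime hζ'
  have hxi' : IsIntegral ℤ (⟨x, hx⟩ : ℚ⟮ζ⟯) :=
    (isIntegral_algebraMap_iff (algebraMap ℚ⟮ζ⟯ K).injective).mp hxi
  obtain ⟨y, hy⟩ := hcl.isIntegral_iff.mp hxi'
  have hmap : (Algebra.adjoin ℤ {AdjoinSimple.gen ℚ ζ}).map (ℚ⟮ζ⟯.val.restrictScalars ℤ)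
      = Algebra.adjoin ℤ {ζ} := by
    rw [AlgHom.map_adjoin, Set.image_singleton]; rfl
  rw [← hmap]
  exact ⟨_, y.2, congrArg Subtype.val hy⟩

lemma mem_intermediateField_of_mem_adjoin {x : K} (hx : x ∈ Algebra.adjoin ℤ {ζ}) : x ∈ ℚ⟮ζ⟯ := by
  have : Algebra.adjoin ℤ {ζ} ≤ ℚ⟮ζ⟯.toSubalgebra.restrictScalars ℤ :=
    Algebra.adjoin_le (by simp)
  exact this hx

lemma finrank_adjoin_int (hζ : IsPrimitiveRoot ζ p) : finrank ℤ (Algebra.adjoin ℤ {ζ}) = p - 1 := by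
  have hi := hζ.isIntegral (Fact.out : p.Prime).pos
  rw [(Algebra.adjoin.powerBasis' hi).finrank, Algebra.adjoin.powerBasis'_dim,
    ← Polynomial.cyclotomic_eq_minpoly hζ (Fact.out : p.Prime).pos, Polynomial.natDegree_cyclotomic,
    Nat.totient_prime Fact.out]

end CyclotomicIntegers

/-! ### The extension `K / ℚ(ζ)` and the integers of `K`. -/

section AdjoinSqrt

open IntermediateField Module

variable {K : Type*} [Field K] [NumberField K] {p d : ℕ} [Fact p.Prime] {ζ s : K}

/-- Otherwise `s` lies in `ℤ[ζ]` and its square vanishes modulo `d`, so `s = d z` by reducedness,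
and `1 = d z²` makes `d` a unit. -/
lemma sqrt_notMem_adjoin (hd1 : 1 < d) (hdsq : Squarefree d) (hdp : d.Coprime p)
    (hζ : IsPrimitiveRoot ζ p) (hs : s ^ 2 = (d : K)) : s ∉ ℚ⟮ζ⟯ := by
  intro h
  have hsi : IsIntegral ℤ s := .of_pow two_pos (hs ▸ isIntegral_natCast d)
  have hd0 : (d : K) ≠ 0 := by exact_mod_cast (zero_lt_one.trans hd1).ne'
  obtain ⟨z, hz, hsz⟩ := exists_eq_mul_of_sq_eq_mul p d hdsq hdp hζ.pow_eq_one
    (mem_adjoin_of_isIntegral hζ h hsi) (one_mem _) (by rw [hs, mul_one])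
  have h1 : ((1 : ℕ) : K) = d * z ^ 2 := by
    apply mul_left_cancel₀ hd0
    rw [Nat.cast_one, mul_one]
    nth_rewrite 1 [← hs]
    rw [hsz]; ring
  have := natCast_dvd_of_eq_mul_isIntegral (zero_lt_one.trans hd1).ne'
    ((isIntegral_of_mem_adjoin hζ hz).pow 2) h1
  exact hd1.ne' (Nat.dvd_one.mp this)

lemma adjoin_sqrt_eq_top (hK : IntermediateField.adjoin ℚ {ζ, s} = ⊤) : ℚ⟮ζ⟯⟮s⟯ = ⊤ := by
  have h := adjoin_adjoin_left ℚ ({ζ} : Set K) {s}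
  rw [Set.singleton_union, hK] at h
  refine eq_top_iff.mpr fun x _ => ?_
  have hx : x ∈ (⊤ : IntermediateField ℚ K) := trivial
  rw [← h] at hx
  exact hx

lemma finrank_adjoin_sqrt (hs : s ^ 2 = (d : K)) (hsF : s ∉ ℚ⟮ζ⟯)
    (hK : IntermediateField.adjoin ℚ {ζ, s} = ⊤) : finrank ℚ⟮ζ⟯ K = 2 := by
  have htop := adjoin_sqrt_eq_top hK
  have hsi : IsIntegral ℚ⟮ζ⟯ s := .of_pow two_pos (hs ▸ isIntegral_natCast d)
  have hsF' : s ∉ (algebraMap ℚ⟮ζ⟯ K).range := by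
    rintro ⟨y, rfl⟩; exact hsF y.2
  rw [← IntermediateField.finrank_top', ← htop, IntermediateField.adjoin.finrank hsi]
  refine le_antisymm ?_ ((minpoly.two_le_natDegree_iff hsi).mpr hsF')
  have h1 : Polynomial.aeval s (Polynomial.X ^ 2 - Polynomial.C (d : ℚ⟮ζ⟯)) = 0 := by
    simp [hs]
  have h2 := Polynomial.natDegree_le_of_dvd (minpoly.dvd _ _ h1)
    (Polynomial.X_pow_sub_C_ne_zero two_pos _)
  rwa [Polynomial.natDegree_X_pow_sub_C] at h2

/-- The field `ℚ(ζ_p, √d)` has degree `2 (p - 1)`. -/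
lemma finrank_rat_eq_two_mul (hζ : IsPrimitiveRoot ζ p) (hs : s ^ 2 = (d : K)) (hsF : s ∉ ℚ⟮ζ⟯)
    (hK : IntermediateField.adjoin ℚ {ζ, s} = ⊤) : finrank ℚ K = 2 * (p - 1) := by
  have hcyc : IsCyclotomicExtension {p} ℚ ℚ⟮ζ⟯ := by
    convert! hζ.intermediateField_adjoin_isCyclotomicExtension ℚ
  have h1 := IsCyclotomicExtension.Rat.finrank p ℚ⟮ζ⟯
  rw [Nat.totient_prime Fact.out] at h1
  have h2 := finrank_mul_finrank ℚ ℚ⟮ζ⟯ K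
  rw [finrank_adjoin_sqrt hs hsF hK, h1] at h2
  rw [← h2, mul_comm]

/-- The nontrivial automorphism of `ℚ(ζ, √d)` over `ℚ(ζ)`. -/
lemma exists_algEquiv_neg (hs : s ^ 2 = (d : K)) (hsF : s ∉ ℚ⟮ζ⟯)
    (hK : IntermediateField.adjoin ℚ {ζ, s} = ⊤) : ∃ g : K ≃ₐ[ℚ⟮ζ⟯] K, g s = -s := by
  have hsF' : s ∉ (algebraMap ℚ⟮ζ⟯ K).range := by
    rintro ⟨y, rfl⟩; exact hsF y.2
  have : Algebra.IsQuadraticExtension ℚ⟮ζ⟯ K := { finrank_eq_two' := finrank_adjoin_sqrt hs hsF hK }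
  have hnf : ¬ ∀ g : K ≃ₐ[ℚ⟮ζ⟯] K, g s = s := by
    rw [← IsGalois.mem_bot_iff_fixed, IntermediateField.mem_bot]
    exact hsF'
  push Not at hnf
  obtain ⟨g, hg⟩ := hnf
  refine ⟨g, (sq_eq_sq_iff_eq_or_eq_neg.mp ?_).resolve_left hg⟩
  rw [← map_pow, hs, map_natCast]

lemma exists_eq_add_mul_of_adjoin_eq_top (hs : s ^ 2 = (d : K))
    (hK : IntermediateField.adjoin ℚ {ζ, s} = ⊤) (x : K) :
    ∃ a ∈ ℚ⟮ζ⟯, ∃ b ∈ ℚ⟮ζ⟯, x = a + b * s := by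
  have hsi : IsAlgebraic ℚ⟮ζ⟯ s :=
    (IsIntegral.of_pow two_pos (hs ▸ isIntegral_natCast d)).isAlgebraic
  have hx : x ∈ Algebra.adjoin ℚ⟮ζ⟯ {s} := by
    rw [← adjoin_simple_toSubalgebra_of_isAlgebraic hsi, adjoin_sqrt_eq_top hK]
    trivial
  induction hx using Algebra.adjoin_induction with
  | mem x hx => exact ⟨0, zero_mem _, 1, one_mem _, by rw [show x = s from hx]; ring⟩
  | algebraMap a => exact ⟨a, a.2, 0, zero_mem _, by rw [zero_mul, add_zero]; rfl⟩
  | add x y _ _ hx hy =>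
    obtain ⟨a, ha, b, hb, rfl⟩ := hx
    obtain ⟨a', ha', b', hb', rfl⟩ := hy
    exact ⟨a + a', add_mem ha ha', b + b', add_mem hb hb', by ring⟩
  | mul x y _ _ hx hy =>
    obtain ⟨a, ha, b, hb, rfl⟩ := hx
    obtain ⟨a', ha', b', hb', rfl⟩ := hy
    refine ⟨a * a' + d * (b * b'), add_mem (mul_mem ha ha')
      (mul_mem (_root_.natCast_mem _ d) (mul_mem hb hb')), a * b' + b * a',
      add_mem (mul_mem ha hb') (mul_mem hb ha'), ?_⟩
    rw [← hs]; ring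

/-- The congruence argument modulo `4`: if `A ^ 2 - d B ^ 2 ∈ 4 ℤ[ζ]`, then `A, B ∈ 2 ℤ[ζ]`. -/
lemma exists_eq_two_mul_of_sq_sub_eq (hp : p ≠ 2) (hd4 : d % 4 = 2 ∨ d % 4 = 3)
    (hζ : IsPrimitiveRoot ζ p) {A B m : K} (hA : A ∈ Algebra.adjoin ℤ {ζ})
    (hB : B ∈ Algebra.adjoin ℤ {ζ}) (hm : m ∈ Algebra.adjoin ℤ {ζ})
    (h : A ^ 2 - d * B ^ 2 = 4 * m) :
    (∃ a ∈ Algebra.adjoin ℤ {ζ}, A = 2 * a) ∧ ∃ b ∈ Algebra.adjoin ℤ {ζ}, B = 2 * b := by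
  have h2p : Nat.Coprime 2 p := (Nat.coprime_primes Nat.prime_two Fact.out).mpr hp.symm
  have red {c y : K} (hc : c ∈ Algebra.adjoin ℤ {ζ}) (hy : y ∈ Algebra.adjoin ℤ {ζ})
      (hcy : c ^ 2 = 2 * y) : ∃ z ∈ Algebra.adjoin ℤ {ζ}, c = 2 * z := by
    simpa using exists_eq_mul_of_sq_eq_prime_mul p 2 h2p hζ.pow_eq_one hc hy (by simpa using hcy)
  have h20 : (2 : K) ≠ 0 := two_ne_zero
  have nat_mem (n : ℕ) : (n : K) ∈ Algebra.adjoin ℤ {ζ} := natCast_mem _ n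
  have two_mem : (2 : K) ∈ Algebra.adjoin ℤ {ζ} := by exact_mod_cast nat_mem 2
  obtain ⟨k, hk⟩ : ∃ k, d = 4 * k + 2 ∨ d = 4 * k + 3 := ⟨d / 4, by omega⟩
  rcases hk with rfl | rfl
  · push_cast at h
    obtain ⟨a, ha, rfl⟩ := red hA
      (add_mem (mul_mem two_mem hm)
        (mul_mem (nat_mem (2 * k + 1)) (pow_mem hB 2))) (by push_cast; linear_combination h)
    obtain ⟨b, hb, rfl⟩ := red hB
      (sub_mem (sub_mem (pow_mem ha 2) hm) (mul_mem (nat_mem k) (pow_mem hB 2)))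
      (mul_left_cancel₀ h20 (by linear_combination -h))
    exact ⟨⟨a, ha, rfl⟩, b, hb, rfl⟩
  -- For `d ≡ 3 mod 4` the relation reads `(A - B)² ≡ 0` modulo `2`, so `A = B + 2c`; substituting
  -- this shows that `2` divides `B²`.
  · push_cast at h
    obtain ⟨c, hc, hAc⟩ := red (sub_mem hA hB)
      (sub_mem (add_mem (mul_mem two_mem hm)
        (mul_mem (nat_mem (2 * k + 2)) (pow_mem hB 2))) (mul_mem hA hB))
        (by push_cast; linear_combination h)
    obtain rfl : A = B + 2 * c := by linear_combination hAc
    obtain ⟨b, hb, rfl⟩ := red hB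
      (sub_mem (sub_mem (add_mem (mul_mem hB hc) (pow_mem hc 2))
        (mul_mem (nat_mem k) (pow_mem hB 2))) hm)
        (mul_left_cancel₀ h20 (by linear_combination -h))
    exact ⟨⟨b + c, add_mem hb hc, by ring⟩, b, hb, rfl⟩

/-- The ring of integers of `ℚ(ζ_p, √d)` is `ℤ[ζ_p] + ℤ[ζ_p] √d`. -/
lemma exists_eq_add_mul_of_isIntegral (hp : p ≠ 2) (hd1 : 1 < d) (hdsq : Squarefree d)
    (hdp : d.Coprime p) (hd4 : d % 4 = 2 ∨ d % 4 = 3) (hζ : IsPrimitiveRoot ζ p)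
    (hs : s ^ 2 = (d : K)) (hK : IntermediateField.adjoin ℚ {ζ, s} = ⊤) {x : K}
    (hx : IsIntegral ℤ x) :
    ∃ a ∈ Algebra.adjoin ℤ {ζ}, ∃ b ∈ Algebra.adjoin ℤ {ζ}, x = a + b * s := by
  obtain ⟨g, hg⟩ := exists_algEquiv_neg hs (sqrt_notMem_adjoin hd1 hdsq hdp hζ hs) hK
  obtain ⟨a, ha, b, hb, rfl⟩ := exists_eq_add_mul_of_adjoin_eq_top hs hK x
  have hsi : IsIntegral ℤ s := .of_pow two_pos (hs ▸ isIntegral_natCast d)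
  have hd0 : (d : K) ≠ 0 := by exact_mod_cast (zero_lt_one.trans hd1).ne'
  have hgx : g (a + b * s) = a - b * s := by
    have h1 : g a = a := g.commutes ⟨a, ha⟩
    have h2 : g b = b := g.commutes ⟨b, hb⟩
    rw [map_add, map_mul, h1, h2, hg]; ring
  have hx' : IsIntegral ℤ (a - b * s) := hgx ▸ hx.map (g.toAlgHom.restrictScalars ℤ)
  have mem {y : K} := mem_adjoin_of_isIntegral (x := y) hζ
  have two_mem : (2 : K) ∈ ℚ⟮ζ⟯ := ofNat_mem _ 2
  have d_mem : (d : K) ∈ ℚ⟮ζ⟯ := _root_.natCast_mem _ d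
  have hA : 2 * a ∈ Algebra.adjoin ℤ {ζ} := mem (mul_mem two_mem ha) (by
    convert! hx.add hx' using 1; ring)
  -- A priori `2b` may have denominator `d`. Both `d(2b)` and `d(2b)²` are integral, and the square
  -- of the first is `d` times the second, so reducedness modulo `d` removes the denominator.
  have hC : d * (2 * b) ∈ Algebra.adjoin ℤ {ζ} := mem (mul_mem d_mem (mul_mem two_mem hb)) (by
    convert! (hx.sub hx').mul hsi using 1; rw [← hs]; ring)
  have hD : d * (2 * b) ^ 2 ∈ Algebra.adjoin ℤ {ζ} :=
    mem (mul_mem d_mem (pow_mem (mul_mem two_mem hb) 2)) (by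
      convert! (hx.sub hx').pow 2 using 1; rw [← hs]; ring)
  have hM : a ^ 2 - d * b ^ 2 ∈ Algebra.adjoin ℤ {ζ} :=
    mem (sub_mem (pow_mem ha 2) (mul_mem d_mem (pow_mem hb 2))) (by
      convert! hx.mul hx' using 1; rw [← hs]; ring)
  obtain ⟨z, hz, hbz⟩ := exists_eq_mul_of_sq_eq_mul p d hdsq hdp hζ.pow_eq_one hC hD (by ring)
  have hB : 2 * b ∈ Algebra.adjoin ℤ {ζ} := by rwa [mul_left_cancel₀ hd0 hbz]
  obtain ⟨⟨a', ha', haa⟩, b', hb', hbb⟩ :=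
    exists_eq_two_mul_of_sq_sub_eq hp hd4 hζ hA hB hM (by ring)
  rw [mul_left_cancel₀ two_ne_zero haa, mul_left_cancel₀ two_ne_zero hbb]
  exact ⟨a', ha', b', hb', rfl⟩

end AdjoinSqrt

/-! ### Euclidean norms of embedded elements. -/

section EmbeddingNorm

variable {K : Type*} [Field K] [NumberField K]

/-- The factor `√2` counts each complex place twice, once for each of its two conjugate embeddings.
-/
lemma norm_adjustedEmbedding_sq (x : K) :
    ‖adjustedEmbedding K x‖ ^ 2 = ∑ σ : K →+* ℂ, ‖σ x‖ ^ 2 := by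
  have h1 : ∑ σ : K →+* ℂ, ‖σ x‖ ^ 2 = ∑ w : InfinitePlace K, w.mult * (w x) ^ 2 := by
    rw [← Finset.sum_fiberwise Finset.univ InfinitePlace.mk (fun σ : K →+* ℂ => ‖σ x‖ ^ 2)]
    refine Finset.sum_congr rfl fun w _ => ?_
    rw [Finset.sum_congr rfl (g := fun _ => (w x) ^ 2), Finset.sum_const, card_filter_mk_eq,
      nsmul_eq_mul]
    intro σ hσ
    rw [← (Finset.mem_filter.mp hσ).2, InfinitePlace.apply]
  rw [h1, EuclideanSpace.norm_sq_eq, Fintype.sum_sum_type, Fintype.sum_prod_type,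
    ← Fintype.sum_subtype_add_sum_subtype (fun w : InfinitePlace K => w.IsReal)]
  congr 1
  · refine Finset.sum_congr rfl fun w _ => ?_
    change ‖embedding_of_isReal w.2 x‖ ^ 2 = _
    rw [norm_embedding_of_isReal, mult_isReal, Nat.cast_one, one_mul]
  · rw [← Fintype.sum_equiv (Equiv.subtypeEquivRight
      fun w : InfinitePlace K => not_isReal_iff_isComplex.symm) _ _ fun _ => rfl]
    refine Finset.sum_congr rfl fun w _ => ?_
    rw [Fin.sum_univ_two]
    change ‖Real.sqrt 2 * (w.1.embedding x).re‖ ^ 2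
      + ‖Real.sqrt 2 * (w.1.embedding x).im‖ ^ 2 = _
    have h3 : ‖w.1.embedding x‖ ^ 2 = (w.1.embedding x).re ^ 2 + (w.1.embedding x).im ^ 2 := by
      rw [← Complex.normSq_eq_norm_sq, Complex.normSq_apply]
      ring
    rw [norm_embedding_eq] at h3
    have h4 : w.1.mult = 2 := mult_isComplex ⟨w.1, w.2⟩
    simp only [Real.norm_eq_abs, sq_abs, mul_pow, Real.sq_sqrt (zero_le_two : (0 : ℝ) ≤ 2),
      Equiv.subtypeEquivRight_apply_coe, h4, h3]
    push_cast
    ring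

/-- AM-GM, in the form `log t ≤ t - 1` summed over the embeddings: the product of the `‖σ x‖²` is
the square of a nonzero integer norm, so it is at least `1`. -/
lemma finrank_le_norm_adjustedEmbedding_sq {x : K} (hx : IsIntegral ℤ x) (hx0 : x ≠ 0) :
    (Module.finrank ℚ K : ℝ) ≤ ‖adjustedEmbedding K x‖ ^ 2 := by
  rw [norm_adjustedEmbedding_sq, ← NumberField.Embeddings.card K ℂ]
  have hpos (σ : K →+* ℂ) : 0 < ‖σ x‖ ^ 2 := by
    have : σ x ≠ 0 := (map_ne_zero σ).mpr hx0
    positivity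
  have hprod : 1 ≤ ∏ σ : K →+* ℂ, ‖σ x‖ ^ 2 := by
    have h1 : ∏ σ : K →+* ℂ, ‖σ x‖ = |(Algebra.norm ℚ x : ℚ)| := by
      rw [← prod_eq_abs_norm, ← Finset.prod_fiberwise Finset.univ InfinitePlace.mk
        (fun σ : K →+* ℂ => ‖σ x‖)]
      refine Finset.prod_congr rfl fun w _ => ?_
      rw [Finset.prod_congr rfl (g := fun _ => w x), Finset.prod_const, card_filter_mk_eq]
      intro σ hσ
      rw [← (Finset.mem_filter.mp hσ).2, InfinitePlace.apply]
    rw [Finset.prod_pow, h1]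
    obtain ⟨n, hn⟩ := IsIntegrallyClosed.isIntegral_iff.mp (Algebra.isIntegral_norm ℚ hx)
    have hn0 : n ≠ 0 := by
      rintro rfl
      rw [map_zero, eq_comm, Algebra.norm_eq_zero_iff] at hn
      exact hx0 hn
    have h2 : (1 : ℚ) ≤ |Algebra.norm ℚ x| := by
      rw [← hn, eq_intCast]
      exact_mod_cast Int.one_le_abs hn0
    have h3 : (1 : ℝ) ≤ |(Algebra.norm ℚ x : ℚ)| := by exact_mod_cast h2
    exact one_le_pow₀ h3
  have hlog : 0 ≤ ∑ σ : K →+* ℂ, Real.log (‖σ x‖ ^ 2) := by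
    rw [← Real.log_prod (fun σ _ => (hpos σ).ne')]
    exact Real.log_nonneg hprod
  have hsum : ∑ σ : K →+* ℂ, (Real.log (‖σ x‖ ^ 2) + 1) ≤ ∑ σ : K →+* ℂ, ‖σ x‖ ^ 2 :=
    Finset.sum_le_sum fun σ _ => by linarith [Real.log_le_sub_one_of_pos (hpos σ)]
  rw [Finset.sum_add_distrib] at hsum
  simp only [Finset.sum_const, Finset.card_univ, nsmul_eq_mul, mul_one] at hsum
  linarith

lemma norm_adjustedEmbedding_ringEquiv_sq (g : K ≃+* K) (x : K) :
    ‖adjustedEmbedding K (g x)‖ ^ 2 = ‖adjustedEmbedding K x‖ ^ 2 := by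
  rw [norm_adjustedEmbedding_sq, norm_adjustedEmbedding_sq]
  let e : (K →+* ℂ) ≃ (K →+* ℂ) :=
    { toFun := fun σ => σ.comp g.toRingHom
      invFun := fun σ => σ.comp g.symm.toRingHom
      left_inv := fun σ => by ext; simp
      right_inv := fun σ => by ext; simp }
  exact Fintype.sum_equiv e _ _ fun _ => rfl

/-- Multiplication by `√d` scales the adjusted canonical embedding by `√d`, and the components
`a` and `b √d` are orthogonal. -/
lemma norm_adjustedEmbedding_add_mul_sq {d : ℕ} {s : K} (hs : s ^ 2 = (d : K)) (g : K ≃+* K)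
    (hg : g s = -s) {a b : K} (ha : g a = a) (hb : g b = b) :
    ‖adjustedEmbedding K (a + b * s)‖ ^ 2
      = ‖adjustedEmbedding K a‖ ^ 2 + d * ‖adjustedEmbedding K b‖ ^ 2 := by
  have h1 := norm_adjustedEmbedding_ringEquiv_sq g (a + b * s)
  rw [map_add, map_mul, ha, hb, hg] at h1
  -- The parallelogram law at each embedding; by `h1` the two summands on the left are equal.
  have h2 : ‖adjustedEmbedding K (a + b * s)‖ ^ 2 + ‖adjustedEmbedding K (a + b * -s)‖ ^ 2
      = 2 * (‖adjustedEmbedding K a‖ ^ 2 + d * ‖adjustedEmbedding K b‖ ^ 2) := by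
    simp only [norm_adjustedEmbedding_sq]
    rw [← Finset.sum_add_distrib, Finset.mul_sum, ← Finset.sum_add_distrib, Finset.mul_sum]
    refine Finset.sum_congr rfl fun σ _ => ?_
    have hσs : ‖σ s‖ ^ 2 = d := by rw [← norm_pow, ← map_pow, hs, map_natCast, Complex.norm_natCast]
    have := parallelogram_law_with_norm ℝ (σ a) (σ b * σ s)
    rw [norm_mul] at this
    rw [map_add, map_add, map_mul, map_mul, map_neg, mul_neg, ← sub_eq_add_neg, ← hσs]
    linear_combination this
  linarith

end EmbeddingNorm

/-! ### Prime subfields and the residue field at `𝔮`. -/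

section PrimeSubfield

lemma mem_range_intCast_iff_mem_bot {k : Type*} [Field k] (q : ℕ) [Fact q.Prime] [CharP k q]
    {z : k} :
    z ∈ (Int.castRingHom k).range ↔ z ∈ (⊥ : Subfield k) := by
  rw [mem_bot_iff_intCast q k]
  rfl

variable {k : Type*} [Field k] (q : ℕ) [Fact q.Prime] [CharP k q]

lemma card_range_intCast : Nat.card (Int.castRingHom k).range = q := by
  rw [← Subfield.card_bot k q]
  exact Nat.card_congr (Equiv.subtypeEquivRight fun _ => mem_range_intCast_iff_mem_bot q)

lemma mem_range_intCast_iff_pow_eq_self {z : k} :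
    z ∈ (Int.castRingHom k).range ↔ z ^ q = z := by
  rw [mem_range_intCast_iff_mem_bot q, Subfield.mem_bot_iff_pow_eq_self]

/-- A field of characteristic `q` which is generated, as a vector space over its prime field, by
`1` and a square root of a nonsquare has `q ^ 2` elements. -/
lemma card_eq_sq_of_forall_eq_add_mul (t : k) (ht : t ∉ (Int.castRingHom k).range)
    (h : ∀ z, ∃ u ∈ (Int.castRingHom k).range, ∃ v ∈ (Int.castRingHom k).range, z = u + v * t) :
    Nat.card k = q ^ 2 := by
  let f : (Int.castRingHom k).range × (Int.castRingHom k).range → k := fun x => x.1 + x.2 * t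
  have hf : Function.Bijective f := by
    refine ⟨?_, fun z => ?_⟩
    · rintro ⟨u, v⟩ ⟨u', v'⟩ huv
      change (u : k) + v * t = u' + v' * t at huv
      have hv : v = v' := by
        by_contra hne
        have hne' : (v : k) - v' ≠ 0 := sub_ne_zero.mpr fun h => hne (Subtype.ext h)
        apply ht
        have : t = (u' - u : k) / (v - v') := by
          rw [eq_div_iff hne']; linear_combination huv
        rw [this, mem_range_intCast_iff_mem_bot q]
        simp only [← SetLike.mem_coe]
        exact div_mem (sub_mem ((mem_range_intCast_iff_mem_bot q).mp u'.2)
          ((mem_range_intCast_iff_mem_bot q).mp u.2))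
          (sub_mem ((mem_range_intCast_iff_mem_bot q).mp v.2)
          ((mem_range_intCast_iff_mem_bot q).mp v'.2))
      subst hv
      rw [Prod.mk.injEq]
      exact ⟨Subtype.ext (add_right_cancel huv), rfl⟩
    · obtain ⟨u, hu, v, hv, rfl⟩ := h z
      exact ⟨(⟨u, hu⟩, ⟨v, hv⟩), rfl⟩
  rw [← Nat.card_congr (Equiv.ofBijective f hf), Nat.card_prod, card_range_intCast q, sq]

end PrimeSubfield

section ResidueField

variable {K : Type*} [Field K]

lemma charP_quotient_of_liesOver (q : ℕ) (𝔮 : Ideal (𝓞 K)) [Fact q.Prime] [𝔮.IsPrime]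
    [𝔮.LiesOver (Ideal.span {(q : ℤ)})] :
    CharP (𝓞 K ⧸ 𝔮) q := by
  have h : (q : 𝓞 K ⧸ 𝔮) = 0 := by
    rw [← map_natCast (Ideal.Quotient.mk 𝔮), Ideal.Quotient.eq_zero_iff_mem]
    exact span_natCast_le_of_liesOver q 𝔮 (Ideal.mem_span_singleton_self _)
  exact (CharP.charP_iff_prime_eq_zero Fact.out).mpr h

lemma isMaximal_of_liesOver [NumberField K] (q : ℕ) (𝔮 : Ideal (𝓞 K)) [Fact q.Prime] [𝔮.IsPrime]
    [𝔮.LiesOver (Ideal.span {(q : ℤ)})] : 𝔮.IsMaximal := by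
  refine Ideal.IsPrime.isMaximal inferInstance fun h => ?_
  have h1 : (q : 𝓞 K) ∈ 𝔮 := span_natCast_le_of_liesOver q 𝔮 (Ideal.mem_span_singleton_self _)
  rw [h, Ideal.mem_bot] at h1
  exact (Fact.out : q.Prime).ne_zero (by exact_mod_cast h1)

lemma mk_sqrt_notMem_primeSubfield {d : ℕ} (q : ℕ) (𝔮 : Ideal (𝓞 K)) [Fact q.Prime] [𝔮.IsPrime]
    [𝔮.LiesOver (Ideal.span {(q : ℤ)})] (hqd : legendreSym q d = -1) {x : 𝓞 K}
    (hx : x ^ 2 = d) :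
    Ideal.Quotient.mk 𝔮 x ∉ primeSubfield 𝔮 := by
  have := charP_quotient_of_liesOver q 𝔮
  rintro ⟨n, hn⟩
  rw [eq_intCast] at hn
  have h1 : ((n ^ 2 - d : ℤ) : 𝓞 K ⧸ 𝔮) = 0 := by
    push_cast
    rw [hn, ← map_pow, hx, map_natCast, sub_self]
  rw [CharP.intCast_eq_zero_iff _ q, ← ZMod.intCast_zmod_eq_zero_iff_dvd] at h1
  push_cast at h1
  refine (legendreSym.eq_neg_one_iff' q).mp hqd ⟨n, ?_⟩
  linear_combination -h1

variable [NumberField K] {p d : ℕ} (q : ℕ) (𝔮 : Ideal (𝓞 K))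

variable [Fact q.Prime] [𝔮.IsPrime] [𝔮.LiesOver (Ideal.span {(q : ℤ)})]

lemma card_primeSubfield : Nat.card (primeSubfield 𝔮) = q := by
  have := charP_quotient_of_liesOver q 𝔮
  have := isMaximal_of_liesOver q 𝔮
  let := Ideal.Quotient.field 𝔮
  exact card_range_intCast q

lemma mem_primeSubfield_iff {z : 𝓞 K ⧸ 𝔮} : z ∈ primeSubfield 𝔮 ↔ z ^ q = z := by
  have := charP_quotient_of_liesOver q 𝔮
  have := isMaximal_of_liesOver q 𝔮
  let := Ideal.Quotient.field 𝔮
  exact mem_range_intCast_iff_pow_eq_self q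

/-- When `q ≡ 1 mod p`, the elements of `ℤ[ζ_p]` reduce to the prime subfield. -/
lemma mk_mem_primeSubfield [Fact p.Prime] (hqp : q ≡ 1 [MOD p]) {ζ : K} (hζ : IsPrimitiveRoot ζ p)
    {x : 𝓞 K} (hx : (x : K) ∈ Algebra.adjoin ℤ {ζ}) :
    Ideal.Quotient.mk 𝔮 x ∈ primeSubfield 𝔮 := by
  -- The induction runs in `K`, so the lift to `𝓞 K` is carried along in the statement.
  suffices h : ∀ y ∈ Algebra.adjoin ℤ {ζ}, ∃ z : 𝓞 K, (z : K) = y ∧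
      Ideal.Quotient.mk 𝔮 z ∈ primeSubfield 𝔮 by
    obtain ⟨z, hz, hz'⟩ := h x hx
    rwa [RingOfIntegers.coe_injective hz] at hz'
  intro y hy
  induction hy using Algebra.adjoin_induction with
  | mem y hy =>
    obtain rfl : y = ζ := hy
    let z : 𝓞 K := ⟨y, hζ.isIntegral (Fact.out : p.Prime).pos⟩
    refine ⟨z, rfl, ?_⟩
    -- The prime subfield is the fixed set of Frobenius, and `ζ ^ q = ζ` because `q ≡ 1 mod p`.
    rw [mem_primeSubfield_iff q, ← map_pow]
    congr 1
    apply RingOfIntegers.coe_injective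
    push_cast
    change y ^ q = y
    rw [pow_eq_pow_of_modEq hqp hζ.pow_eq_one, pow_one]
  | algebraMap n => exact ⟨n, by simp, n, by simp⟩
  | add x y _ _ hx hy =>
    obtain ⟨u, rfl, hu⟩ := hx
    obtain ⟨v, rfl, hv⟩ := hy
    exact ⟨u + v, by simp, by rw [map_add]; exact add_mem hu hv⟩
  | mul x y _ _ hx hy =>
    obtain ⟨u, rfl, hu⟩ := hx
    obtain ⟨v, rfl, hv⟩ := hy
    exact ⟨u * v, by simp, by rw [map_mul]; exact mul_mem hu hv⟩

lemma card_quotient_eq_sq [Fact p.Prime] (hp : p ≠ 2) (hd1 : 1 < d) (hdsq : Squarefree d)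
    (hdp : d.Coprime p) (hd4 : d % 4 = 2 ∨ d % 4 = 3) (hqp : q ≡ 1 [MOD p])
    (hqd : legendreSym q d = -1) {ζ s : K} (hζ : IsPrimitiveRoot ζ p)
    (hs : s ^ 2 = (d : K)) (hK : IntermediateField.adjoin ℚ {ζ, s} = ⊤) :
    Nat.card (𝓞 K ⧸ 𝔮) = q ^ 2 := by
  have := charP_quotient_of_liesOver q 𝔮
  have := isMaximal_of_liesOver q 𝔮
  let := Ideal.Quotient.field 𝔮
  let s' : 𝓞 K := ⟨s, .of_pow two_pos (hs ▸ isIntegral_natCast d)⟩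
  have hs' : s' ^ 2 = d := RingOfIntegers.coe_injective (by push_cast; exact hs)
  refine card_eq_sq_of_forall_eq_add_mul q (Ideal.Quotient.mk 𝔮 s')
    (mk_sqrt_notMem_primeSubfield q 𝔮 hqd hs') fun z => ?_
  obtain ⟨x, rfl⟩ := Ideal.Quotient.mk_surjective z
  obtain ⟨a, ha, b, hb, hx⟩ :=
    exists_eq_add_mul_of_isIntegral hp hd1 hdsq hdp hd4 hζ hs hK x.isIntegral_coe
  let a' : 𝓞 K := ⟨a, isIntegral_of_mem_adjoin hζ ha⟩
  let b' : 𝓞 K := ⟨b, isIntegral_of_mem_adjoin hζ hb⟩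
  refine ⟨_, mk_mem_primeSubfield q 𝔮 hqp hζ (x := a') ha, _,
    mk_mem_primeSubfield q 𝔮 hqp hζ (x := b') hb, ?_⟩
  have hx' : x = a' + b' * s' := RingOfIntegers.coe_injective (by push_cast; exact hx)
  rw [hx', map_add, map_mul]

end ResidueField

/-! ### From Gaussian sums to probabilities, and the closed form of the constant. -/

section Probability

lemma PMF.ofReal_one_sub_le_toOuterMeasure {α : Type*} (P : PMF α) {A : Set α} {c : ℝ}
    (hc : 0 ≤ c) (h : P.toOuterMeasure Aᶜ ≤ ENNReal.ofReal c) :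
    ENNReal.ofReal (1 - c) ≤ P.toOuterMeasure A := by
  have h1 : P.toOuterMeasure A + P.toOuterMeasure Aᶜ = 1 := by
    rw [PMF.toOuterMeasure_apply, PMF.toOuterMeasure_apply, ← ENNReal.tsum_add, ← P.tsum_coe]
    exact tsum_congr fun x => congrFun (Set.indicator_self_add_compl A P) x
  rw [ENNReal.ofReal_sub _ hc, ENNReal.ofReal_one, tsub_le_iff_right, ← h1]
  gcongr

lemma discreteGaussian_toOuterMeasure_le {E : Type*} [NormedAddCommGroup E] [NormedSpace ℝ E]
    [FiniteDimensional ℝ E] (L : Submodule ℤ E) [DiscreteTopology L] {r : ℝ} (hr : 0 < r)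
    {A : Set L} {c : ℝ≥0∞}
    (h : ∑' x : L, A.indicator (fun x => ENNReal.ofReal (gaussianWeight r (x : E))) x
      ≤ c * ∑' x : L, ENNReal.ofReal (gaussianWeight r (x : E))) :
    (discreteGaussian L hr).toOuterMeasure A ≤ c := by
  have h1 (x : L) : A.indicator (discreteGaussian L hr) x
      = A.indicator (fun x => ENNReal.ofReal (gaussianWeight r (x : E))) x
        * (∑' x : L, ENNReal.ofReal (gaussianWeight r (x : E)))⁻¹ := by
    by_cases hx : x ∈ A
    · rw [Set.indicator_of_mem hx, Set.indicator_of_mem hx]; rfl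
    · rw [Set.indicator_of_notMem hx, Set.indicator_of_notMem hx, zero_mul]
  rw [PMF.toOuterMeasure_apply, tsum_congr h1, ENNReal.tsum_mul_right, ← div_eq_mul_inv]
  exact ENNReal.div_le_of_le_mul h

lemma ofReal_gaussianWeight {E : Type*} [NormedAddCommGroup E] (r : ℝ) (x : E) :
    ENNReal.ofReal (gaussianWeight r x) = expWeight (Real.pi / r ^ 2) x := by
  rw [gaussianWeight, expWeight]
  congr 2
  ring

/-- The constant in the tail bound, in closed form. -/
lemma exp_mul_rpow_eq (n : ℕ) {d r : ℝ} (hd : 0 < d) (hr : 0 < r) :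
    Real.exp (-(Real.pi * d / r ^ 2 - 1 / 4) * (2 * n : ℕ))
        * (Real.pi * d / r ^ 2 / (1 / 4)) ^ (n / 2 : ℝ)
      = (Real.sqrt (4 * Real.pi * Real.exp 1 * d) / r
        * Real.exp (-(2 * Real.pi * d) / r ^ 2)) ^ n := by
  -- The `e` under the root comes from `e^{γ · 2n} = (√e)^n` with `γ = 1/4`.
  have h1 : Real.sqrt (4 * Real.pi * Real.exp 1 * d) / r
      = Real.sqrt (Real.pi * d / r ^ 2 / (1 / 4)) * Real.exp (1 / 2) := by
    rw [Real.exp_half, ← Real.sqrt_mul (by positivity), div_eq_iff hr.ne',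
      show 4 * Real.pi * Real.exp 1 * d = Real.pi * d / r ^ 2 / (1 / 4) * Real.exp 1 * r ^ 2 by
        field_simp,
      Real.sqrt_mul (by positivity) (r ^ 2), Real.sqrt_sq hr.le]
  rw [h1, mul_assoc, ← Real.exp_add, mul_pow, ← Real.exp_nat_mul, mul_comm,
    Real.sqrt_eq_rpow, ← Real.rpow_mul_natCast (by positivity)]
  congr 2
  · ring
  · push_cast
    ring

end Probability

/-! ### The tail bound on `ι(ℤ[ζ])` and the orthogonal splitting of `R`. -/

section CyclotomicLattice

variable {K : Type*} [Field K] [NumberField K] {p d : ℕ} [Fact p.Prime] {ζ s : K}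

/-- The adjusted canonical embedding restricted to `ℤ[ζ]`. -/
def cyclotomicEmbedding (ζ : K) :
    Algebra.adjoin ℤ {ζ} →ₗ[ℤ] EuclideanSpace ℝ (index K) :=
  ((adjustedEmbedding K).comp (Algebra.adjoin ℤ {ζ}).subtype.toAddMonoidHom).toIntLinearMap

lemma tsum_cyclotomic_expWeight_le (hd1 : 1 < d) (hdsq : Squarefree d) (hdp : d.Coprime p)
    (hζ : IsPrimitiveRoot ζ p) (hs : s ^ 2 = (d : K))
    (hK : IntermediateField.adjoin ℚ {ζ, s} = ⊤) {r : ℝ} (hr0 : 0 < r)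
    (hr : r < 2 * Real.sqrt (Real.pi * d)) :
    ∑' b : Algebra.adjoin ℤ {ζ},
      (if b = 0 then 0 else expWeight (Real.pi * d / r ^ 2) (adjustedEmbedding K b))
      ≤ ENNReal.ofReal ((Real.sqrt (4 * Real.pi * Real.exp 1 * d) / r
          * Real.exp (-(2 * Real.pi * d) / r ^ 2)) ^ (p - 1))
        * ∑' b : Algebra.adjoin ℤ {ζ},
          expWeight (Real.pi * d / r ^ 2) (adjustedEmbedding K b) := by
  set L : Submodule ℤ (EuclideanSpace ℝ (index K)) := LinearMap.range (cyclotomicEmbedding ζ)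
  have hint (b : Algebra.adjoin ℤ {ζ}) : IsIntegral ℤ (b : K) := isIntegral_of_mem_adjoin hζ b.2
  have hle : L ≤ ringLattice K := by
    rintro _ ⟨b, rfl⟩
    exact ⟨⟨b, hint b⟩, rfl⟩
  have : DiscreteTopology L := DiscreteTopology.of_subset (ringLattice_discreteTopology K) hle
  have hinj : Function.Injective (cyclotomicEmbedding ζ) := by
    intro a b hab
    have h1 : (⟨a, hint a⟩ : 𝓞 K) = ⟨b, hint b⟩ := integerEmbedding_injective K hab
    exact Subtype.ext (congrArg (fun x : 𝓞 K => (x : K)) h1)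
  let e := LinearEquiv.ofInjective (cyclotomicEmbedding ζ) hinj
  have hrank : Module.finrank ℤ L = p - 1 := by
    rw [← e.finrank_eq, finrank_adjoin_int hζ]
  have hdR : (0 : ℝ) < d := by exact_mod_cast zero_lt_one.trans hd1
  -- Equivalent to `r < 2√(πd)`.
  have hlt : (1 / 4 : ℝ) < Real.pi * d / r ^ 2 := by
    rw [lt_div_iff₀ (by positivity)]
    have h1 := Real.sq_sqrt (show 0 ≤ Real.pi * d by positivity)
    nlinarith [Real.sqrt_nonneg (Real.pi * d)]
  have hR : ∀ x ∈ L, x ≠ 0 → ((2 * (p - 1) : ℕ) : ℝ) ≤ ‖x‖ ^ 2 := by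
    rintro _ ⟨b, rfl⟩ hb
    rw [← finrank_rat_eq_two_mul hζ hs (sqrt_notMem_adjoin hd1 hdsq hdp hζ hs) hK]
    refine finrank_le_norm_adjustedEmbedding_sq (hint b) fun h => hb ?_
    rw [show b = 0 from Subtype.ext h, map_zero]
  -- The value `γ = 1/4` minimizes `e^{γR} γ^{-n/2}` for `R = 2n`.
  have key := tsum_expWeight_ne_zero_le L (by norm_num : (0 : ℝ) < 1 / 4) hlt hR
  rw [hrank, exp_mul_rpow_eq (p - 1) hdR hr0, ← e.toEquiv.tsum_eq, ← e.toEquiv.tsum_eq] at key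
  simp only [LinearEquiv.coe_toEquiv, EmbeddingLike.map_eq_zero_iff] at key
  exact key

end CyclotomicLattice

section Decomposition

variable {K : Type*} [Field K] [NumberField K] {p d : ℕ} [Fact p.Prime] {ζ s : K}

/-- The decomposition `𝓞 K = ℤ[ζ] ⊕ ℤ[ζ] √d` for `K = ℚ(ζ, √d)`, which is orthogonal for the
adjusted canonical embedding. -/
lemma exists_equiv_ringOfIntegers (hp : p ≠ 2) (hd1 : 1 < d) (hdsq : Squarefree d)
    (hdp : d.Coprime p) (hd4 : d % 4 = 2 ∨ d % 4 = 3) (hζ : IsPrimitiveRoot ζ p)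
    (hs : s ^ 2 = (d : K)) (hK : IntermediateField.adjoin ℚ {ζ, s} = ⊤) :
    ∃ e : Algebra.adjoin ℤ {ζ} × Algebra.adjoin ℤ {ζ} ≃ 𝓞 K,
      (∀ x, (e x : K) = x.1 + x.2 * s) ∧ ∀ x, ‖adjustedEmbedding K (e x)‖ ^ 2
        = ‖adjustedEmbedding K x.1‖ ^ 2 + d * ‖adjustedEmbedding K x.2‖ ^ 2 := by
  obtain ⟨g, hg⟩ := exists_algEquiv_neg hs (sqrt_notMem_adjoin hd1 hdsq hdp hζ hs) hK
  have hgS (a : Algebra.adjoin ℤ {ζ}) : g (a : K) = a :=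
    g.commutes ⟨a, mem_intermediateField_of_mem_adjoin a.2⟩
  have hsi : IsIntegral ℤ s := .of_pow two_pos (hs ▸ isIntegral_natCast d)
  have hs0 : s ≠ 0 := by
    rintro rfl
    have hd0 : (d : K) ≠ 0 := by exact_mod_cast (zero_lt_one.trans hd1).ne'
    exact hd0 (by rw [← hs]; ring)
  let f : Algebra.adjoin ℤ {ζ} × Algebra.adjoin ℤ {ζ} → 𝓞 K := fun x =>
    ⟨x.1 + x.2 * s, (isIntegral_of_mem_adjoin hζ x.1.2).add
      ((isIntegral_of_mem_adjoin hζ x.2.2).mul hsi)⟩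
  have hf : Function.Bijective f := by
    constructor
    · rintro ⟨a, b⟩ ⟨a', b'⟩ hab
      have h1 : (a : K) + b * s = a' + b' * s := congrArg (fun x : 𝓞 K => (x : K)) hab
      have h2 := congrArg g h1
      simp only [map_add, map_mul, hgS, hg] at h2
      have ha : (a : K) = a' := mul_left_cancel₀ two_ne_zero (by linear_combination h1 + h2)
      have hb : (b : K) = b' := mul_right_cancel₀ hs0 (by linear_combination h1 - ha)
      rw [Prod.mk.injEq]
      exact ⟨Subtype.ext ha, Subtype.ext hb⟩
    · intro x
      obtain ⟨a, ha, b, hb, hx⟩ :=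
        exists_eq_add_mul_of_isIntegral hp hd1 hdsq hdp hd4 hζ hs hK x.isIntegral_coe
      exact ⟨(⟨a, ha⟩, ⟨b, hb⟩), RingOfIntegers.coe_injective hx.symm⟩
  refine ⟨Equiv.ofBijective f hf, fun x => rfl, fun x => ?_⟩
  exact norm_adjustedEmbedding_add_mul_sq hs g.toRingEquiv hg (hgS x.1) (hgS x.2)

/-- The mass outside `ℤ[ζ]` of the discrete Gaussian on the ring of integers. -/
lemma tsum_indicator_expWeight_le (hd1 : 1 < d) (hdsq : Squarefree d) (hdp : d.Coprime p)
    (hζ : IsPrimitiveRoot ζ p) (hs : s ^ 2 = (d : K))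
    (hK : IntermediateField.adjoin ℚ {ζ, s} = ⊤) {r : ℝ} (hr0 : 0 < r)
    (hr : r < 2 * Real.sqrt (Real.pi * d))
    (e : Algebra.adjoin ℤ {ζ} × Algebra.adjoin ℤ {ζ} ≃ 𝓞 K)
    (he : ∀ x, ‖adjustedEmbedding K (e x)‖ ^ 2
        = ‖adjustedEmbedding K x.1‖ ^ 2 + d * ‖adjustedEmbedding K x.2‖ ^ 2)
    {A : Set (𝓞 K)} (hA : ∀ x, x.2 = 0 → e x ∉ A) :
    ∑' x : 𝓞 K, A.indicator (fun x => expWeight (Real.pi / r ^ 2) (adjustedEmbedding K x)) x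
      ≤ ENNReal.ofReal ((Real.sqrt (4 * Real.pi * Real.exp 1 * d) / r
          * Real.exp (-(2 * Real.pi * d) / r ^ 2)) ^ (p - 1))
        * ∑' x : 𝓞 K, expWeight (Real.pi / r ^ 2) (adjustedEmbedding K x) := by
  have hw (x) : expWeight (Real.pi / r ^ 2) (adjustedEmbedding K (e x))
      = expWeight (Real.pi / r ^ 2) (adjustedEmbedding K x.1)
        * expWeight (Real.pi * d / r ^ 2) (adjustedEmbedding K x.2) := by
    simp only [expWeight]
    rw [← ENNReal.ofReal_mul (Real.exp_pos _).le, ← Real.exp_add, he]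
    congr 2
    ring
  -- `A` contains no element with `b = 0`, so its mass is at most the full sum over `a` times the
  -- sum over `b ≠ 0`.
  have hle (x) : A.indicator (fun x => expWeight (Real.pi / r ^ 2) (adjustedEmbedding K x)) (e x)
      ≤ expWeight (Real.pi / r ^ 2) (adjustedEmbedding K x.1)
        * (if x.2 = 0 then 0 else expWeight (Real.pi * d / r ^ 2) (adjustedEmbedding K x.2)) := by
    split_ifs with h
    · rw [Set.indicator_of_notMem (hA x h), mul_zero]
    · rw [← hw]
      exact Set.indicator_le_self _ _ _
  rw [← e.tsum_eq, ← e.tsum_eq (fun x : 𝓞 K => expWeight (Real.pi / r ^ 2) (adjustedEmbedding K x))]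
  refine (ENNReal.tsum_le_tsum hle).trans ?_
  simp_rw [hw]
  have hprod (u v : Algebra.adjoin ℤ {ζ} → ℝ≥0∞) :
      ∑' x : Algebra.adjoin ℤ {ζ} × Algebra.adjoin ℤ {ζ}, u x.1 * v x.2
        = (∑' a, u a) * ∑' b, v b := by
    rw [ENNReal.tsum_prod']
    simp only [ENNReal.tsum_mul_left, ENNReal.tsum_mul_right]
  rw [hprod (fun a => expWeight (Real.pi / r ^ 2) (adjustedEmbedding K a)) fun b =>
      if b = 0 then 0 else expWeight (Real.pi * d / r ^ 2) (adjustedEmbedding K b),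
    hprod (fun a => expWeight (Real.pi / r ^ 2) (adjustedEmbedding K a)) fun b =>
      expWeight (Real.pi * d / r ^ 2) (adjustedEmbedding K b), mul_left_comm]
  exact mul_le_mul_right (tsum_cyclotomic_expWeight_le hd1 hdsq hdp hζ hs hK hr0 hr) _

end Decomposition

end

theorem mainTheorem2 {K : Type*} [Field K] [NumberField K]
    (p d q : ℕ) [Fact p.Prime] (hp : p ≠ 2)
    (hd1 : 1 < d) (hdsq : Squarefree d) (hdp : d.Coprime p) (hd4 : d % 4 = 2 ∨ d % 4 = 3)
    [Fact q.Prime] (hqp : q ≡ 1 [MOD p]) (hqd : legendreSym q d = -1)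
    -- `K = ℚ(ζ_p, √d)`
    (ζ s : K) (hζ : IsPrimitiveRoot ζ p) (hs : s ^ 2 = (d : K))
    (hK : IntermediateField.adjoin ℚ {ζ, s} = ⊤)
    (𝔮 : Ideal (𝓞 K)) [𝔮.IsPrime] [𝔮.LiesOver (Ideal.span {(q : ℤ)})]
    (r : ℝ) (hr0 : 0 < r) (hr : r < 2 * Real.sqrt (Real.pi * d))
    (β : ℝ)
    (hβ : β = min ((Real.sqrt (4 * Real.pi * Real.exp 1 * d) / r
      * Real.exp (-(2 * Real.pi * d) / r ^ 2)) ^ (p - 1)) 1) :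
    Nat.card (𝓞 K ⧸ 𝔮) = q ^ 2 ∧ Nat.card (primeSubfield 𝔮) = q ∧
      ENNReal.ofReal (1 - β) ≤ (errorDistributionMod K q hr0).toOuterMeasure
        {x | reductionMap q 𝔮 x ∈ primeSubfield 𝔮} := by
  refine ⟨card_quotient_eq_sq q 𝔮 hp hd1 hdsq hdp hd4 hqp hqd hζ hs hK,
    card_primeSubfield q 𝔮, ?_⟩
  set C := (Real.sqrt (4 * Real.pi * Real.exp 1 * d) / r
    * Real.exp (-(2 * Real.pi * d) / r ^ 2)) ^ (p - 1)
  have hC : 0 ≤ C := by positivity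
  -- If `C ≥ 1` then `β = 1` and the bound is vacuous.
  rcases le_total 1 C with h1 | h1
  · rw [hβ, min_eq_right h1, sub_self, ENNReal.ofReal_zero]
    exact zero_le
  rw [hβ, min_eq_left h1, errorDistributionMod, PMF.toOuterMeasure_map_apply, errorDistribution,
    PMF.toOuterMeasure_map_apply]
  refine PMF.ofReal_one_sub_le_toOuterMeasure _ hC (discreteGaussian_toOuterMeasure_le _ hr0 ?_)
  obtain ⟨e, he, hnorm⟩ := exists_equiv_ringOfIntegers hp hd1 hdsq hdp hd4 hζ hs hK
  -- Applied to the set of elements whose reduction leaves `𝔽_q`; it avoids `ℤ[ζ]`.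
  have key := tsum_indicator_expWeight_le hd1 hdsq hdp hζ hs hK hr0 hr e hnorm
    (A := {x | Ideal.Quotient.mk 𝔮 x ∉ primeSubfield 𝔮}) fun x hx h => h
      (mk_mem_primeSubfield q 𝔮 hqp hζ (by rw [he, hx]; simp))
  rw [← (ringLatticeEquiv K).toEquiv.tsum_eq, ← (ringLatticeEquiv K).toEquiv.tsum_eq
    fun x : ringLattice K => ENNReal.ofReal (gaussianWeight r (x : EuclideanSpace ℝ (index K)))]
  refine Eq.trans_le ?_ (key.trans_eq ?_)
  · refine tsum_congr fun x => ?_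
    simp only [Set.indicator, ofReal_gaussianWeight]
    have h2 : (ringLatticeEquiv K).toEquiv x ∈
        ((ringLatticeEquiv K).symm ⁻¹' (Ideal.Quotient.mk (Ideal.span {(q : 𝓞 K)}) ⁻¹'
          {x | reductionMap q 𝔮 x ∈ primeSubfield 𝔮}))ᶜ ↔
        x ∈ {x | Ideal.Quotient.mk 𝔮 x ∉ primeSubfield 𝔮} := by
      simp [reductionMap]
    exact if_congr h2 rfl rfl
  · congr 1
    exact tsum_congr fun x => (ofReal_gaussianWeight r _).symm
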